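/- For a finite set $A$ of positive integers let $X_A\subset[0,1]$ be the limit set of the maps $T_a(x)=\frac{1}{x+a}$, $a\in A$, that is, $$X_A=\Bigl\{\lim_{n\to\infty}T_{a_1}\circ\cdots\circ T_{a_n}(0) : a_k\in A \text{ for all } k\ge 1\Bigr\},$$ the set of all infinite continued fractions $[0;a_1,a_2,\dots]$ with digits in $A$. Let $D_A$ be the set of integers $q\ge 1$ for which there exist an integer $p\ge 1$ with $\gcd(p,q)=1$, an integer $n\ge 1$ and $a_1,\dots,a_n\in A$ such that $$\frac pq=[0;a_1,\dots,a_n]=\cfrac{1}{a_1+\cfrac{1}{a_2+\cfrac{1}{\ddots+\cfrac{1}{a_n}}}} .$$ If the Hausdorff dimension of $X_A$ satisfies $\dim_H(X_A)>\frac56$, then $A$ has no local obstructions: for every integer $m\ge1$ the reduction map $D_A\to\mathbb Z/m\mathbb Z$, $q\mapsto q \bmod m$, is surjective. -/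

import Mathlib

open Filter Topology

/-- The contraction `T_a(x) = 1 / (x + a)` attached to the digit `a`. -/
noncomputable def digitMap (a : ℕ) (x : ℝ) : ℝ := 1 / (x + a)

/-- The composition `T_{a 0} ∘ T_{a 1} ∘ ⋯ ∘ T_{a (n - 1)}`. -/
noncomputable def digitComp (a : ℕ → ℕ) : ℕ → ℝ → ℝ
  | 0 => id
  | n + 1 => digitComp a n ∘ digitMap (a n)

/-- The limit set `X_A`: all limits `lim_n (T_{a 0} ∘ ⋯ ∘ T_{a (n - 1)}) (0)` over digit
sequences in `A`, that is, all infinite continued fractions `[0; a 0, a 1, …]` with digits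
in `A`. -/
def limitSet (A : Set ℕ) : Set ℝ :=
  {x | ∃ a : ℕ → ℕ, (∀ k, a k ∈ A) ∧ Tendsto (fun n => digitComp a n 0) atTop (𝓝 x)}

/-- The value of the finite continued fraction `[0; a₁, …, aₙ] = 1 / (a₁ + 1 / (a₂ + ⋯))`. -/
def finiteCF : List ℕ → ℚ
  | [] => 0
  | a :: l => 1 / (a + finiteCF l)

/-- The set `D_A` of positive integers `q` for which there are `p` coprime to `q` and
`a₁, …, aₙ ∈ A` with `n ≥ 1` and `p / q = [0; a₁, …, aₙ]`. -/
def cfDenominators (A : Set ℕ) : Set ℕ :=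
  {q | 0 < q ∧ ∃ p : ℕ, 0 < p ∧ Nat.Coprime p q ∧
    ∃ l : List ℕ, l ≠ [] ∧ (∀ a ∈ l, a ∈ A) ∧ (p : ℚ) / (q : ℚ) = finiteCF l}

/-- `A` has no local obstructions: for every `m ≥ 1`, reduction modulo `m` maps the
denominators `D_A` onto `ℤ/m`. -/
def NoLocalObstructions (A : Set ℕ) : Prop :=
  ∀ m : ℕ, 1 ≤ m → (fun q : ℕ => (q : ZMod m)) '' cfDenominators A = Set.univ

/-!
Two things can go wrong: all digits are even, or no two digits differ by at most `2`. In either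
case `limitSet A` is too small. In the coordinate `1 / (3 + 2 * x)` the digit map `T_a` contracts
`[0, 1]` by the factor `(5 / (3 * a + 5)) ^ 2`, so the dimension is at most `5 / 6` once
`∑ (5 / (3 * a + 5)) ^ (5 / 3) ≤ 1`. Moving the digits down to `2, 4, 6, …`, respectively
`1, 4, 7, …`, only increases this sum, and even there it is smaller than `1`.

Otherwise `A` has an odd digit and two digits whose difference is `1` or `2`. Continued fractions
are products of the matrices `D_a = !![0, 1; 1, a]`, the denominator being the entry `(1, 1)`. As
`GL₂(ℤ/m)` is finite, the words in the `D_a` modulo `m` form a group. It contains the shear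
`D_a⁻¹ * D_b` by `b - a`, hence the shear by `2`, hence `D_n` for every odd `n`. The entries
`(1, 1)` of `D_{2k+1}` and of `D_1 * D_{2k-1}` are `2k + 1` and `2k`.
-/

section LocalObstructions

open Matrix Matrix.GeneralLinearGroup

theorem exists_list_prod_map_eq_of_mem_closure {ι G : Type*} [Group G] [Finite G] {f : ι → G}
    {s : Set ι} (hs : s.Nonempty) {g : G} (hg : g ∈ Subgroup.closure (f '' s)) :
    ∃ l : List ι, l ≠ [] ∧ (∀ i ∈ l, i ∈ s) ∧ (l.map f).prod = g := by
  have exists_word : ∀ h ∈ Subgroup.closure (f '' s),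
      ∃ l : List ι, (∀ i ∈ l, i ∈ s) ∧ (l.map f).prod = h := by
    intro h hh
    rw [← Subgroup.mem_toSubmonoid, Subgroup.closure_toSubmonoid_of_finite] at hh
    induction hh using Submonoid.closure_induction_left with
    | one => exact ⟨[], by simp⟩
    | mul_left _ hx _ _ ih =>
      obtain ⟨i, hi, rfl⟩ := hx
      obtain ⟨l, hl, rfl⟩ := ih
      exact ⟨i :: l, by simpa using ⟨hi, hl⟩, by simp⟩
  obtain ⟨i, hi⟩ := hs
  have hfi : f i ∈ Subgroup.closure (f '' s) := Subgroup.subset_closure ⟨i, hi, rfl⟩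
  obtain ⟨l, hl, hprod⟩ := exists_word ((f i)⁻¹ * g) (mul_mem (inv_mem hfi) hg)
  exact ⟨i :: l, List.cons_ne_nil i l, by simpa using ⟨hi, hl⟩, by simp [hprod]⟩

theorem finiteCF_nonneg (l : List ℕ) : 0 ≤ finiteCF l := by
  induction l with
  | nil => exact le_rfl
  | cons a l ih => rw [finiteCF]; positivity

theorem num_finiteCF_cons {a : ℕ} (ha : 1 ≤ a) (l : List ℕ) :
    (finiteCF (a :: l)).num = (finiteCF l).den := by
  have hl := finiteCF_nonneg l
  have hsum : 0 < (a : ℚ) + finiteCF l := by positivity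
  rw [finiteCF, one_div, Rat.num_inv, Int.sign_eq_one_of_pos (Rat.num_pos.2 hsum), one_mul,
    Rat.natCast_add_den]

theorem den_finiteCF_cons {a : ℕ} (ha : 1 ≤ a) (l : List ℕ) :
    ((finiteCF (a :: l)).den : ℤ) = (finiteCF l).num + a * (finiteCF l).den := by
  have hl := finiteCF_nonneg l
  have hsum : 0 < (a : ℚ) + finiteCF l := by positivity
  have hnum : ((a : ℚ) + finiteCF l).num = (finiteCF l).num + a * (finiteCF l).den := by
    rw [← Rat.intCast_inj, ← Rat.mul_den_eq_num, Rat.natCast_add_den, add_mul,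
      Rat.mul_den_eq_num]
    push_cast
    ring
  rw [finiteCF, one_div, Rat.den_inv_of_ne_zero hsum.ne',
    Int.natAbs_of_nonneg (Rat.num_pos.2 hsum).le, hnum]

theorem den_finiteCF_mem_cfDenominators {A : Set ℕ} (hA : ∀ a ∈ A, 1 ≤ a) {l : List ℕ}
    (hne : l ≠ []) (hl : ∀ a ∈ l, a ∈ A) : (finiteCF l).den ∈ cfDenominators A := by
  have hpos : 0 < (finiteCF l).num := by
    obtain ⟨a, l, rfl⟩ := List.exists_cons_of_ne_nil hne
    rw [num_finiteCF_cons (hA a (hl a List.mem_cons_self))]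
    exact_mod_cast (finiteCF l).den_pos
  refine ⟨(finiteCF l).den_pos, (finiteCF l).num.natAbs, Int.natAbs_pos.2 hpos.ne',
    (finiteCF l).reduced, l, hne, hl, ?_⟩
  rw [Nat.cast_natAbs, abs_of_pos hpos, Rat.num_div_den]

section DigitMatrix

variable {R : Type*} [CommRing R]

/-- The invertible matrix of the Möbius transformation `z ↦ 1 / (z + x)`. -/
def digitMatrix (x : R) : GL (Fin 2) R where
  val := !![0, 1; 1, x]
  inv := !![-x, 1; 1, 0]
  val_inv := by simp [one_fin_two]
  inv_val := by simp [one_fin_two]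

theorem coe_digitMatrix (x : R) :
    (digitMatrix x : Matrix (Fin 2) (Fin 2) R) = !![0, 1; 1, x] :=
  rfl

theorem digitMatrix_apply_one_one (x : R) : digitMatrix x 1 1 = x :=
  rfl

theorem digitMatrix_mul_digitMatrix_apply_one_one (x y : R) :
    (digitMatrix x * digitMatrix y) 1 1 = 1 + x * y := by
  simp [coe_digitMatrix, mul_apply]

theorem prod_map_digitMatrix_apply_one {l : List ℕ} (hl : ∀ a ∈ l, 1 ≤ a) :
    (l.map fun a : ℕ => digitMatrix (a : R)).prod 0 1 = ((finiteCF l).num : R) ∧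
      (l.map fun a : ℕ => digitMatrix (a : R)).prod 1 1 = ((finiteCF l).den : R) := by
  induction l with
  | nil => simp [finiteCF]
  | cons a l ih =>
    obtain ⟨ha, hl⟩ := List.forall_mem_cons.1 hl
    have hden := congrArg (Int.cast : ℤ → R) (den_finiteCF_cons ha l)
    push_cast at hden
    rw [List.map_cons, List.prod_cons, num_finiteCF_cons ha, hden]
    simp [coe_digitMatrix, mul_apply, ih hl]

theorem digitMatrix_mul_upperRightHom (x t : R) :
    digitMatrix x * upperRightHom t = digitMatrix (x + t) := by
  simp [Units.ext_iff, digitMatrix, add_comm]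

theorem upperRightHom_sub (x y : R) :
    upperRightHom (y - x) = (digitMatrix x)⁻¹ * digitMatrix y := by
  rw [eq_inv_mul_iff_mul_eq, digitMatrix_mul_upperRightHom, add_sub_cancel]

theorem sub_mem_strictPeriods_of_digitMatrix_mem {H : Subgroup (GL (Fin 2) R)} {x y : R}
    (hx : digitMatrix x ∈ H) (hy : digitMatrix y ∈ H) : y - x ∈ H.strictPeriods := by
  rw [Subgroup.mem_strictPeriods_iff, upperRightHom_sub]
  exact mul_mem (inv_mem hx) hy

theorem digitMatrix_add_mem {H : Subgroup (GL (Fin 2) R)} {x t : R} (hx : digitMatrix x ∈ H)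
    (ht : t ∈ H.strictPeriods) : digitMatrix (x + t) ∈ H := by
  rw [← digitMatrix_mul_upperRightHom]
  exact mul_mem hx (Subgroup.mem_strictPeriods_iff.1 ht)

variable (R) in
/-- The subgroup of `GL₂(R)` generated by the matrices of the digits in `A`. For `R = ℤ/m` it
records the residues of numerators and denominators of continued fractions with digits in `A`. -/
def digitGroup (A : Set ℕ) : Subgroup (GL (Fin 2) R) :=
  Subgroup.closure ((fun a : ℕ => digitMatrix (a : R)) '' A)

theorem digitMatrix_natCast_mem_digitGroup {A : Set ℕ} {a : ℕ} (ha : a ∈ A) :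
    digitMatrix (a : R) ∈ digitGroup R A :=
  Subgroup.subset_closure ⟨a, ha, rfl⟩

theorem two_mem_strictPeriods_digitGroup {A : Set ℕ} {a b : ℕ} (ha : a ∈ A) (hb : b ∈ A)
    (hlt : a < b) (hle : b ≤ a + 2) : (2 : R) ∈ (digitGroup R A).strictPeriods := by
  have hsub := sub_mem_strictPeriods_of_digitMatrix_mem (R := R)
    (digitMatrix_natCast_mem_digitGroup ha) (digitMatrix_natCast_mem_digitGroup hb)
  obtain rfl | rfl : b = a + 1 ∨ b = a + 2 := by omega
  · simpa [one_add_one_eq_two] using add_mem hsub hsub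
  · simpa using hsub

theorem digitMatrix_two_mul_add_one_mem_digitGroup {A : Set ℕ} {c : ℕ} (hc : c ∈ A) (hodd : Odd c)
    (h2 : (2 : R) ∈ (digitGroup R A).strictPeriods) (n : ℤ) :
    digitMatrix (2 * n + 1 : R) ∈ digitGroup R A := by
  obtain ⟨k, rfl⟩ := hodd
  have hshift := digitMatrix_add_mem (digitMatrix_natCast_mem_digitGroup hc)
    (zsmul_mem h2 (n - k))
  convert hshift using 2
  push_cast [zsmul_eq_mul]
  ring

end DigitMatrix

theorem apply_one_one_mem_image_cfDenominators {A : Set ℕ} (hne : A.Nonempty)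
    (hA : ∀ a ∈ A, 1 ≤ a) {m : ℕ} [NeZero m] {M : GL (Fin 2) (ZMod m)}
    (hM : M ∈ digitGroup (ZMod m) A) :
    M 1 1 ∈ (fun q : ℕ => (q : ZMod m)) '' cfDenominators A := by
  obtain ⟨l, hl, hlA, rfl⟩ := exists_list_prod_map_eq_of_mem_closure hne hM
  exact ⟨_, den_finiteCF_mem_cfDenominators hA hl hlA,
    (prod_map_digitMatrix_apply_one fun a ha => hA a (hlA a ha)).2.symm⟩

theorem noLocalObstructions_of_odd_of_lt_of_le {A : Set ℕ} (hA : ∀ a ∈ A, 1 ≤ a)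
    {a b c : ℕ} (ha : a ∈ A) (hb : b ∈ A) (hc : c ∈ A) (hodd : Odd c) (hlt : a < b)
    (hle : b ≤ a + 2) : NoLocalObstructions A := by
  intro m hm
  have : NeZero m := ⟨by omega⟩
  have odd_mem (n : ℤ) : digitMatrix (2 * n + 1 : ZMod m) ∈ digitGroup (ZMod m) A :=
    digitMatrix_two_mul_add_one_mem_digitGroup hc hodd
      (two_mem_strictPeriods_digitGroup ha hb hlt hle) n
  have entry_mem {M} (hM : M ∈ digitGroup (ZMod m) A) :=
    apply_one_one_mem_image_cfDenominators ⟨c, hc⟩ hA hM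
  refine Set.eq_univ_of_forall fun y => ?_
  obtain ⟨q, rfl⟩ := ZMod.intCast_surjective y
  obtain ⟨k, rfl | rfl⟩ := Int.even_or_odd' q
  · convert entry_mem (mul_mem (odd_mem 0) (odd_mem (k - 1))) using 1
    rw [digitMatrix_mul_digitMatrix_apply_one_one]
    push_cast
    ring
  · convert entry_mem (odd_mem k) using 1
    rw [digitMatrix_apply_one_one]
    push_cast
    rfl

end LocalObstructions

section SubSelfSimilarSets

open scoped ENNReal NNReal

variable {ι : Type*}

theorem tsum_prod_fin_eq_tsum_pow (f : ι → ℝ≥0∞) (n : ℕ) :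
    ∑' w : Fin n → ι, ∏ k, f (w k) = (∑' i, f i) ^ n := by
  induction n with
  | zero => simp
  | succ n ih =>
    rw [← (Fin.consEquiv fun _ : Fin (n + 1) => ι).tsum_eq, ENNReal.tsum_prod']
    simp only [Fin.consEquiv_apply, Fin.prod_univ_succ, Fin.cons_zero, Fin.cons_succ,
      ENNReal.tsum_mul_left, ENNReal.tsum_mul_right, ih, pow_succ']

variable {X : Type*} [EMetricSpace X] {f : ι → X → X} {ρ : ι → ℝ≥0} {s : Set X}

theorem exists_subset_iUnion_ediam_le_prod (hf : ∀ i, LipschitzOnWith (ρ i) (f i) s)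
    (hs : s ⊆ ⋃ i, f i '' s) (n : ℕ) :
    ∃ U : (Fin n → ι) → Set X, s ⊆ ⋃ w, U w ∧
      ∀ w, U w ⊆ s ∧ Metric.ediam (U w) ≤ (∏ k, (ρ (w k) : ℝ≥0∞)) * Metric.ediam s := by
  induction n with
  | zero => exact ⟨fun _ => s, Set.subset_iUnion (fun _ : Fin 0 → ι => s) Fin.elim0, by simp⟩
  | succ n ih =>
    obtain ⟨U, hcover, hU⟩ := ih
    refine ⟨fun w => s ∩ f (w 0) '' U (Fin.tail w), fun x hx => ?_, fun w =>
      ⟨Set.inter_subset_left, ?_⟩⟩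
    · obtain ⟨i, y, hy, rfl⟩ := Set.mem_iUnion.1 (hs hx)
      obtain ⟨w, hw⟩ := Set.mem_iUnion.1 (hcover hy)
      exact Set.mem_iUnion.2 ⟨Fin.cons i w, hx, y, by simpa using hw, by simp⟩
    · obtain ⟨hsub, hdiam⟩ := hU (Fin.tail w)
      calc Metric.ediam (s ∩ f (w 0) '' U (Fin.tail w))
          ≤ Metric.ediam (f (w 0) '' U (Fin.tail w)) := Metric.ediam_mono Set.inter_subset_right
        _ ≤ ρ (w 0) * Metric.ediam (U (Fin.tail w)) :=
          Metric.ediam_image_le_iff.2 fun x hx y hy =>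
            (hf (w 0) (hsub hx) (hsub hy)).trans <|
              mul_le_mul_right (Metric.edist_le_ediam_of_mem hx hy) _
        _ ≤ ρ (w 0) * ((∏ k, (ρ (Fin.tail w k) : ℝ≥0∞)) * Metric.ediam s) := by gcongr
        _ = (∏ k, (ρ (w k) : ℝ≥0∞)) * Metric.ediam s := by
          rw [Fin.prod_univ_succ, mul_assoc]
          rfl

theorem dimH_le_of_subset_iUnion_image [Countable ι] (hf : ∀ i, LipschitzOnWith (ρ i) (f i) s)
    (hs : s ⊆ ⋃ i, f i '' s) (hbdd : Metric.ediam s ≠ ∞) {r : ℝ≥0} (hr : r < 1)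
    (hρ : ∀ i, ρ i ≤ r) {d : ℝ≥0} (hsum : ∑' i, (ρ i : ℝ≥0∞) ^ (d : ℝ) ≤ 1) : dimH s ≤ d := by
  borelize X
  choose U hcover hU using fun n => exists_subset_iUnion_ediam_le_prod hf hs n
  have mesh_le (n : ℕ) (w : Fin n → ι) :
      Metric.ediam (U n w) ≤ (r : ℝ≥0∞) ^ n * Metric.ediam s := by
    refine (hU n w).2.trans ?_
    gcongr
    exact_mod_cast (Finset.prod_le_pow_card _ _ r fun k _ => hρ (w k)).trans_eq (by simp)
  have mesh_tendsto : Tendsto (fun n => (r : ℝ≥0∞) ^ n * Metric.ediam s) atTop (𝓝 0) := by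
    simpa using ENNReal.Tendsto.mul_const
      (ENNReal.tendsto_pow_atTop_nhds_zero_of_lt_one (by exact_mod_cast hr)) (Or.inr hbdd)
  have sum_le (n : ℕ) :
      ∑' w : Fin n → ι, Metric.ediam (U n w) ^ (d : ℝ) ≤ Metric.ediam s ^ (d : ℝ) :=
    calc ∑' w : Fin n → ι, Metric.ediam (U n w) ^ (d : ℝ)
        ≤ ∑' w : Fin n → ι, (∏ k, (ρ (w k) : ℝ≥0∞) ^ (d : ℝ)) * Metric.ediam s ^ (d : ℝ) := by
          gcongr with w
          rw [ENNReal.prod_rpow_of_nonneg d.coe_nonneg,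
            ← ENNReal.mul_rpow_of_nonneg _ _ d.coe_nonneg]
          gcongr
          exact (hU n w).2
      _ = (∑' i, (ρ i : ℝ≥0∞) ^ (d : ℝ)) ^ n * Metric.ediam s ^ (d : ℝ) := by
          rw [ENNReal.tsum_mul_right, tsum_prod_fin_eq_tsum_pow fun i => (ρ i : ℝ≥0∞) ^ (d : ℝ)]
      _ ≤ Metric.ediam s ^ (d : ℝ) := mul_le_of_le_one_left' (pow_le_one' hsum n)
  refine dimH_le_of_hausdorffMeasure_ne_top (ne_top_of_le_ne_top
    (ENNReal.rpow_ne_top_of_nonneg d.coe_nonneg hbdd) ?_)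
  exact (MeasureTheory.Measure.hausdorffMeasure_le_liminf_tsum (d : ℝ) s _ mesh_tendsto U
    (.of_forall mesh_le) (.of_forall hcover)).trans <|
      (liminf_le_liminf (.of_forall sum_le)).trans_eq (liminf_const _)

theorem dimH_le_dimH_image_of_antilipschitzWith_domRestrict {Y : Type*} [EMetricSpace Y]
    {φ : X → Y} {K : ℝ≥0} (hφ : AntilipschitzWith K (s.domRestrict φ)) :
    dimH s ≤ dimH (φ '' s) := by
  calc dimH s = dimH (Subtype.val '' (Set.univ : Set s)) := by
        rw [Set.image_univ, Subtype.range_coe]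
    _ = dimH (Set.univ : Set s) := isometry_subtype_coe.dimH_image _
    _ ≤ dimH (s.domRestrict φ '' Set.univ) := hφ.le_dimH_image _
    _ = dimH (φ '' s) := by rw [Set.image_univ, Set.range_domRestrict]

theorem dimH_le_of_subset_iUnion_image_of_antilipschitzWith_domRestrict {X Y : Type*}
    [MetricSpace X] [MetricSpace Y] [Countable ι] {f : ι → X → X} {φ : X → Y} {s : Set X}
    {ρ : ι → ℝ≥0} {K : ℝ≥0}
    (hφ : AntilipschitzWith K (s.domRestrict φ))
    (hf : ∀ i, ∀ x ∈ s, ∀ y ∈ s, dist (φ (f i x)) (φ (f i y)) ≤ ρ i * dist (φ x) (φ y))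
    (hs : s ⊆ ⋃ i, f i '' s) (hbdd : Bornology.IsBounded (φ '' s)) {r : ℝ≥0} (hr : r < 1)
    (hρ : ∀ i, ρ i ≤ r) {d : ℝ≥0} (hsum : ∑' i, (ρ i : ℝ≥0∞) ^ (d : ℝ) ≤ 1) : dimH s ≤ d := by
  obtain rfl | ⟨x₀, -⟩ := s.eq_empty_or_nonempty
  · simp
  have : Nonempty X := ⟨x₀⟩
  have left_inv : Set.LeftInvOn (Function.invFunOn φ s) φ s :=
    (Set.injOn_iff_injective.2 hφ.injective).leftInvOn_invFunOn
  let g (i : ι) : Y → Y := φ ∘ f i ∘ Function.invFunOn φ s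
  have g_apply (i : ι) {x : X} (hx : x ∈ s) : g i (φ x) = φ (f i x) :=
    congrArg (φ ∘ f i) (left_inv hx)
  refine (dimH_le_dimH_image_of_antilipschitzWith_domRestrict hφ).trans
    (dimH_le_of_subset_iUnion_image (f := g) (fun i => LipschitzOnWith.of_dist_le_mul ?_) ?_
      hbdd.ediam_ne_top hr hρ hsum)
  · rintro _ ⟨x, hx, rfl⟩ _ ⟨y, hy, rfl⟩
    rw [g_apply i hx, g_apply i hy]
    exact hf i x hx y hy
  · rintro _ ⟨x, hx, rfl⟩
    obtain ⟨i, y, hy, rfl⟩ := Set.mem_iUnion.1 (hs hx)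
    exact Set.mem_iUnion.2 ⟨i, φ y, Set.mem_image_of_mem φ hy, g_apply i hy⟩

end SubSelfSimilarSets

section LimitSet

open scoped ENNReal NNReal
open Set

theorem digitMap_mem_Icc {a : ℕ} (ha : 1 ≤ a) {x : ℝ} (hx : 0 ≤ x) :
    digitMap a x ∈ Icc (0 : ℝ) 1 := by
  have ha' : (1 : ℝ) ≤ a := by exact_mod_cast ha
  refine ⟨?_, ?_⟩ <;> rw [digitMap]
  · positivity
  · exact div_le_one_of_le₀ (by linarith) (by linarith)

theorem inv_digitMap (a : ℕ) (x : ℝ) : (digitMap a x)⁻¹ = x + a := by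
  rw [digitMap, one_div, inv_inv]

theorem digitComp_succ' (a : ℕ → ℕ) (n : ℕ) (x : ℝ) :
    digitComp a (n + 1) x = digitMap (a 0) (digitComp (fun k => a (k + 1)) n x) := by
  induction n generalizing x with
  | zero => rfl
  | succ n ih => exact ih (digitMap (a (n + 1)) x)

theorem digitComp_mem_Icc {a : ℕ → ℕ} (ha : ∀ k, 1 ≤ a k) (n : ℕ) {x : ℝ}
    (hx : x ∈ Icc (0 : ℝ) 1) : digitComp a n x ∈ Icc (0 : ℝ) 1 := by
  induction n generalizing x with
  | zero => exact hx
  | succ n ih => exact ih (digitMap_mem_Icc (ha n) hx.1)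

theorem limitSet_subset_Icc {A : Set ℕ} (hA : ∀ a ∈ A, 1 ≤ a) : limitSet A ⊆ Icc 0 1 := by
  rintro x ⟨a, ha, hx⟩
  exact isClosed_Icc.mem_of_tendsto hx <|
    .of_forall fun n => digitComp_mem_Icc (fun k => hA _ (ha k)) n ⟨le_rfl, zero_le_one⟩

theorem limitSet_subset_iUnion_image_digitMap {A : Set ℕ} (hA : ∀ a ∈ A, 1 ≤ a) :
    limitSet A ⊆ ⋃ a : A, digitMap a '' limitSet A := by
  rintro x ⟨a, ha, hx⟩
  set tail : ℕ → ℝ := fun n => digitComp (fun k => a (k + 1)) n 0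
  have tail_mem (n : ℕ) : tail n ∈ Icc (0 : ℝ) 1 :=
    digitComp_mem_Icc (fun k => hA _ (ha (k + 1))) n ⟨le_rfl, zero_le_one⟩
  have hx_tail : Tendsto (fun n => digitMap (a 0) (tail n)) atTop (𝓝 x) := by
    simpa only [digitComp_succ'] using (tendsto_add_atTop_iff_nat 1).2 hx
  have hx_pos : 0 < x := by
    have lower (n : ℕ) : 1 / (1 + a 0 : ℝ) ≤ digitMap (a 0) (tail n) := by
      have ha0 : (1 : ℝ) ≤ a 0 := by exact_mod_cast hA _ (ha 0)
      have := tail_mem n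
      rw [digitMap]
      gcongr
      exacts [by linarith [this.1], this.2]
    exact lt_of_lt_of_le (by positivity) (ge_of_tendsto' hx_tail lower)
  have tail_tendsto : Tendsto tail atTop (𝓝 (x⁻¹ - a 0)) := by
    simpa only [inv_digitMap, add_sub_cancel_right] using
      (hx_tail.inv₀ hx_pos.ne').sub_const (a 0 : ℝ)
  refine mem_iUnion.2 ⟨⟨a 0, ha 0⟩, x⁻¹ - a 0, ⟨_, fun k => ha (k + 1), tail_tendsto⟩, ?_⟩
  rw [digitMap, sub_add_cancel, one_div, inv_inv]

/-- A Möbius coordinate on `[0, 1]` in which every digit map contracts, whereas `|T₁'(0)| = 1` in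
the standard coordinate. Its pole `-3 / 2` approximates the repelling fixed point `-(1 + √5) / 2`
of `T₁`, which as a pole would make `T₁` affine. -/
noncomputable def mobiusCoord (x : ℝ) : ℝ := 1 / (3 + 2 * x)

/-- A Lipschitz constant of the digit map `T_a` on `[0, 1]` with respect to `mobiusCoord`, namely
its derivative in this coordinate at `x = 1`, where it is largest. -/
noncomputable def digitRatio (a : ℕ) : ℝ≥0 := (5 / (3 * a + 5)) ^ 2

theorem digitRatio_antitone : Antitone digitRatio := by
  intro a b hab
  unfold digitRatio
  gcongr

theorem dist_mobiusCoord {x y : ℝ} (hx : 0 ≤ x) (hy : 0 ≤ y) :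
    dist (mobiusCoord x) (mobiusCoord y) = 2 * mobiusCoord x * mobiusCoord y * dist x y := by
  have hsub : mobiusCoord x - mobiusCoord y = 2 * mobiusCoord x * mobiusCoord y * (y - x) := by
    unfold mobiusCoord
    field_simp
    ring
  have hfactor : 0 ≤ 2 * mobiusCoord x * mobiusCoord y := by
    unfold mobiusCoord
    positivity
  rw [Real.dist_eq, hsub, abs_mul, abs_of_nonneg hfactor, dist_comm, Real.dist_eq]

theorem dist_mobiusCoord_digitMap {a : ℕ} (ha : 1 ≤ a) {x y : ℝ} (hx : 0 ≤ x) (hy : 0 ≤ y) :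
    dist (mobiusCoord (digitMap a x)) (mobiusCoord (digitMap a y))
      = 2 * (1 / (3 * x + 3 * a + 2)) * (1 / (3 * y + 3 * a + 2)) * dist x y := by
  have ha' : (1 : ℝ) ≤ a := by exact_mod_cast ha
  have hsub : mobiusCoord (digitMap a x) - mobiusCoord (digitMap a y)
      = 2 * (1 / (3 * x + 3 * a + 2)) * (1 / (3 * y + 3 * a + 2)) * (x - y) := by
    have : 0 < x + a := by linarith
    have : 0 < y + a := by linarith
    unfold mobiusCoord digitMap
    field_simp
    ring
  rw [Real.dist_eq, hsub, abs_mul, abs_of_nonneg (by positivity), Real.dist_eq]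

theorem inv_le_mul_mobiusCoord {a x : ℝ} (ha : 1 ≤ a) (hx : x ∈ Icc (0 : ℝ) 1) :
    1 / (3 * x + 3 * a + 2) ≤ 5 / (3 * a + 5) * mobiusCoord x := by
  obtain ⟨hx0, hx1⟩ := hx
  rw [mobiusCoord, div_mul_div_comm, div_le_div_iff₀ (by positivity) (by positivity)]
  nlinarith [mul_nonneg (sub_nonneg.2 ha) (sub_nonneg.2 hx1)]

theorem dist_mobiusCoord_digitMap_le {a : ℕ} (ha : 1 ≤ a) {x y : ℝ} (hx : x ∈ Icc (0 : ℝ) 1)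
    (hy : y ∈ Icc (0 : ℝ) 1) :
    dist (mobiusCoord (digitMap a x)) (mobiusCoord (digitMap a y))
      ≤ digitRatio a * dist (mobiusCoord x) (mobiusCoord y) := by
  have ha' : (1 : ℝ) ≤ a := by exact_mod_cast ha
  have hx0 := hx.1
  have hy0 := hy.1
  calc dist (mobiusCoord (digitMap a x)) (mobiusCoord (digitMap a y))
      = 2 * (1 / (3 * x + 3 * a + 2)) * (1 / (3 * y + 3 * a + 2)) * dist x y :=
        dist_mobiusCoord_digitMap ha hx0 hy0
    _ ≤ 2 * (5 / (3 * a + 5) * mobiusCoord x) * (5 / (3 * a + 5) * mobiusCoord y) * dist x y := by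
        gcongr ?_ * ?_ * _
        · have : 0 ≤ mobiusCoord x := by unfold mobiusCoord; positivity
          positivity
        · gcongr
          exact inv_le_mul_mobiusCoord ha' hx
        · exact inv_le_mul_mobiusCoord ha' hy
    _ = digitRatio a * dist (mobiusCoord x) (mobiusCoord y) := by
        rw [dist_mobiusCoord hx0 hy0, digitRatio]
        push_cast
        ring

theorem dist_le_mul_dist_mobiusCoord {x y : ℝ} (hx : x ∈ Icc (0 : ℝ) 1)
    (hy : y ∈ Icc (0 : ℝ) 1) : dist x y ≤ 25 / 2 * dist (mobiusCoord x) (mobiusCoord y) := by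
  have coord_ge {z : ℝ} (hz : z ∈ Icc (0 : ℝ) 1) : 1 / 5 ≤ mobiusCoord z := by
    obtain ⟨hz0, hz1⟩ := hz
    unfold mobiusCoord
    gcongr
    linarith
  have hx5 := coord_ge hx
  have hy5 := coord_ge hy
  calc dist x y = 25 / 2 * (2 * (1 / 5) * (1 / 5) * dist x y) := by ring
    _ ≤ 25 / 2 * (2 * mobiusCoord x * mobiusCoord y * dist x y) := by gcongr
    _ = 25 / 2 * dist (mobiusCoord x) (mobiusCoord y) := by rw [dist_mobiusCoord hx.1 hy.1]

theorem isBounded_image_mobiusCoord_Icc : Bornology.IsBounded (mobiusCoord '' Icc 0 1) := by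
  refine (isCompact_Icc.image_of_continuousOn ?_).isBounded
  refine continuousOn_const.div (by fun_prop) fun x hx => ?_
  linarith [hx.1]

theorem dimH_limitSet_le {A : Set ℕ} (hA : ∀ a ∈ A, 1 ≤ a) {d : ℝ≥0}
    (hsum : ∑' a : A, (digitRatio a : ℝ≥0∞) ^ (d : ℝ) ≤ 1) : dimH (limitSet A) ≤ d := by
  have hIcc := limitSet_subset_Icc hA
  refine dimH_le_of_subset_iUnion_image_of_antilipschitzWith_domRestrict (ι := A) (K := 25 / 2)
    (.of_le_mul_dist fun x y => ?_)
    (fun a x hx y hy => dist_mobiusCoord_digitMap_le (hA a a.2) (hIcc hx) (hIcc hy))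
    (limitSet_subset_iUnion_image_digitMap hA)
    (isBounded_image_mobiusCoord_Icc.subset (image_mono hIcc)) (r := digitRatio 1) ?_
    (fun a => digitRatio_antitone (hA a a.2)) hsum
  · exact_mod_cast dist_le_mul_dist_mobiusCoord (hIcc x.2) (hIcc y.2)
  · rw [digitRatio, ← NNReal.coe_lt_coe]
    norm_num

end LimitSet

section SeparatedDigits

open scoped ENNReal NNReal
open Finset

theorem tsum_le_tsum_add_mul_of_separated {A : Set ℕ} {r d : ℕ} (hd : 0 < d)
    (hr : ∀ a ∈ A, r ≤ a) (hsep : ∀ a ∈ A, ∀ b ∈ A, a < b → a + d ≤ b) {f : ℕ → ℝ≥0∞}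
    (hf : Antitone f) : ∑' a : A, f a ≤ ∑' k : ℕ, f (r + d * k) := by
  let index (a : A) : ℕ := (a - r) / d
  have index_strictMono : StrictMono index := fun a b hab => by
    have hgap := hsep a a.2 b b.2 hab
    have hra := hr a a.2
    rw [← Nat.add_one_le_iff, ← Nat.add_div_right _ hd]
    exact Nat.div_le_div_right (by omega)
  calc ∑' a : A, f a ≤ ∑' a : A, f (r + d * index a) := by
        gcongr with a
        apply hf
        have := Nat.mul_div_le (a - r) d
        have := hr a a.2
        simp only [index]
        omega
    _ ≤ ∑' k : ℕ, f (r + d * k) :=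
      ENNReal.tsum_comp_le_tsum_of_injective index_strictMono.injective fun k => f (r + d * k)

theorem sum_range_rpow_neg_le {c s : ℝ} (hc : 0 < c) (hs : 0 < s) (n : ℕ) :
    ∑ i ∈ range n, (c + (i + 1 : ℕ)) ^ (-(s + 1)) ≤ c ^ (-s) / s := by
  have hanti : AntitoneOn (fun x : ℝ => x ^ (-(s + 1))) (Set.Icc c (c + n)) :=
    fun x hx y _ hxy => Real.rpow_le_rpow_of_nonpos (hc.trans_le hx.1) hxy (by linarith)
  calc ∑ i ∈ range n, (c + (i + 1 : ℕ)) ^ (-(s + 1))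
      ≤ ∫ x in c..c + n, x ^ (-(s + 1)) := hanti.sum_le_integral
    _ = (c ^ (-s) - (c + n) ^ (-s)) / s := by
      rw [integral_rpow (Or.inr ⟨by linarith, Set.notMem_uIcc_of_lt hc (by positivity)⟩)]
      rw [show -(s + 1) + 1 = -s by ring, div_neg, ← neg_div, neg_sub]
    _ ≤ c ^ (-s) / s := by
      gcongr
      exact sub_le_self _ (by positivity)

theorem sum_range_div_rpow_le {c q s : ℝ} (hc : 0 < c) (hq : 0 ≤ q) (hs : 0 < s) (n : ℕ) :
    ∑ k ∈ range n, (q / (c + (k + 1 : ℕ))) ^ (s + 1) ≤ q / s * (q / c) ^ s := by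
  calc ∑ k ∈ range n, (q / (c + (k + 1 : ℕ))) ^ (s + 1)
      = q ^ (s + 1) * ∑ k ∈ range n, (c + (k + 1 : ℕ)) ^ (-(s + 1)) := by
        rw [mul_sum]
        refine sum_congr rfl fun k _ => ?_
        rw [Real.div_rpow hq (by positivity), Real.rpow_neg (by positivity), div_eq_mul_inv]
    _ ≤ q ^ (s + 1) * (c ^ (-s) / s) := by
        gcongr
        exact sum_range_rpow_neg_le hc hs n
    _ = q / s * (q / c) ^ s := by
        rw [Real.rpow_add_one' hq (by linarith), Real.rpow_neg hc.le, Real.div_rpow hq hc.le]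
        ring

theorem tsum_ofReal_div_rpow_le {c q s : ℝ} (hc : 0 < c) (hq : 0 ≤ q) (hs : 0 < s) :
    ∑' k : ℕ, ENNReal.ofReal ((q / (c + k)) ^ (s + 1)) ≤
      ENNReal.ofReal ((q / c) ^ (s + 1) + (q / (c + 1)) ^ (s + 1) + q / s * (q / (c + 1)) ^ s) := by
  refine ENNReal.tsum_le_of_sum_range_le fun n => ?_
  rw [← ENNReal.ofReal_sum_of_nonneg fun k _ => by positivity]
  refine ENNReal.ofReal_le_ofReal ?_
  calc ∑ k ∈ range n, (q / (c + k)) ^ (s + 1)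
      ≤ ∑ k ∈ range (n + 1 + 1), (q / (c + k)) ^ (s + 1) :=
        sum_le_sum_of_subset_of_nonneg (range_mono (by omega)) fun k _ _ => by positivity
    _ = ∑ k ∈ range n, (q / (c + 1 + (k + 1 : ℕ))) ^ (s + 1)
        + (q / (c + 1)) ^ (s + 1) + (q / c) ^ (s + 1) := by
        rw [sum_range_succ', sum_range_succ']
        simp only [Nat.cast_add, Nat.cast_one, Nat.cast_zero, add_zero, zero_add, add_assoc,
          add_comm (1 : ℝ)]
    _ ≤ q / s * (q / (c + 1)) ^ s + (q / (c + 1)) ^ (s + 1) + (q / c) ^ (s + 1) := by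
        gcongr
        exact sum_range_div_rpow_le (by positivity) hq hs n
    _ = _ := by ring

theorem coe_digitRatio_add_mul_rpow {d : ℕ} (hd : 0 < d) (r k : ℕ) {t : ℝ} (ht : 0 ≤ t) :
    (digitRatio (r + d * k) : ℝ≥0∞) ^ t =
      ENNReal.ofReal ((5 / (3 * d) / ((3 * r + 5) / (3 * d) + k)) ^ (2 * t)) := by
  have hbase : (5 / (3 * d) / ((3 * r + 5) / (3 * d) + k) : ℝ) = 5 / (3 * (r + d * k : ℕ) + 5) := by
    push_cast
    field_simp
    ring
  rw [hbase, Real.rpow_mul (by positivity), ← ENNReal.ofReal_rpow_of_nonneg (by positivity) ht,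
    Real.rpow_two, ← ENNReal.ofReal_coe_nnreal, digitRatio]
  push_cast
  rfl

theorem dimH_limitSet_le_of_separated {A : Set ℕ} {r d : ℕ} (hr : 1 ≤ r) (hd : 0 < d)
    (hA : ∀ a ∈ A, r ≤ a) (hsep : ∀ a ∈ A, ∀ b ∈ A, a < b → a + d ≤ b) {t : ℝ≥0} (ht : 1 / 2 < t)
    (hsum : (5 / (3 * r + 5) : ℝ) ^ (2 * t : ℝ) + (5 / (3 * (r + d) + 5) : ℝ) ^ (2 * t : ℝ) +
      5 / (3 * d * (2 * t - 1)) * (5 / (3 * (r + d) + 5) : ℝ) ^ (2 * t - 1 : ℝ) ≤ 1) :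
    dimH (limitSet A) ≤ t := by
  have hs : (0 : ℝ) < 2 * t - 1 := by
    have : (1 / 2 : ℝ) < t := by exact_mod_cast ht
    linarith
  refine dimH_limitSet_le (fun a ha => hr.trans (hA a ha)) ?_
  calc ∑' a : A, (digitRatio a : ℝ≥0∞) ^ (t : ℝ)
      ≤ ∑' k : ℕ, (digitRatio (r + d * k) : ℝ≥0∞) ^ (t : ℝ) :=
        tsum_le_tsum_add_mul_of_separated hd hA hsep
          (f := fun a => (digitRatio a : ℝ≥0∞) ^ (t : ℝ)) fun a b hab => by
            beta_reduce
            gcongr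
            exact digitRatio_antitone hab
    _ = ∑' k : ℕ, ENNReal.ofReal
          ((5 / (3 * d) / ((3 * r + 5) / (3 * d) + k)) ^ (2 * t - 1 + 1 : ℝ)) := by
        simp only [coe_digitRatio_add_mul_rpow hd r _ t.coe_nonneg, sub_add_cancel]
    _ ≤ 1 := by
        have hfirst : (5 / (3 * d) / ((3 * r + 5) / (3 * d)) : ℝ) = 5 / (3 * r + 5) := by
          field_simp
        have hsecond :
            (5 / (3 * d) / ((3 * r + 5) / (3 * d) + 1) : ℝ) = 5 / (3 * (r + d) + 5) := by
          field_simp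
          ring
        refine (tsum_ofReal_div_rpow_le (by positivity) (by positivity) hs).trans ?_
        rw [hfirst, hsecond, div_div, sub_add_cancel]
        exact ENNReal.ofReal_le_one.2 hsum

theorem rpow_div_le_of_pow_le_pow {x y : ℝ} (hx : 0 ≤ x) (hy : 0 ≤ y) {m n : ℕ} (hn : n ≠ 0)
    (h : x ^ m ≤ y ^ n) : x ^ (m / n : ℝ) ≤ y := by
  rw [div_eq_mul_inv, Real.rpow_mul hx, Real.rpow_natCast]
  exact (Real.rpow_le_rpow (by positivity) h (by positivity)).trans_eq
    (Real.pow_rpow_inv_natCast hy hn)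

theorem five_div_seventeen_rpow_five_thirds_le : (5 / 17 : ℝ) ^ (5 / 3 : ℝ) ≤ 131 / 1000 := by
  exact_mod_cast rpow_div_le_of_pow_le_pow (x := 5 / 17) (y := 131 / 1000) (m := 5) (n := 3)
    (by norm_num) (by norm_num) (by norm_num) (by norm_num)

theorem five_div_seventeen_rpow_two_thirds_le : (5 / 17 : ℝ) ^ (2 / 3 : ℝ) ≤ 443 / 1000 := by
  exact_mod_cast rpow_div_le_of_pow_le_pow (x := 5 / 17) (y := 443 / 1000) (m := 2) (n := 3)
    (by norm_num) (by norm_num) (by norm_num) (by norm_num)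

theorem dimH_limitSet_le_of_forall_even {A : Set ℕ} (hA : ∀ a ∈ A, 1 ≤ a)
    (heven : ∀ a ∈ A, Even a) : dimH (limitSet A) ≤ 5 / 6 := by
  have two_le (a) (ha : a ∈ A) : 2 ≤ a := by
    have := hA a ha
    have := heven a ha
    grind
  have add_two_le (a) (ha : a ∈ A) (b) (hb : b ∈ A) (hab : a < b) : a + 2 ≤ b := by
    have := heven a ha
    have := heven b hb
    grind
  have hfirst : (5 / 11 : ℝ) ^ (5 / 3 : ℝ) ≤ 27 / 100 := by
    exact_mod_cast rpow_div_le_of_pow_le_pow (x := 5 / 11) (y := 27 / 100) (m := 5) (n := 3)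
      (by norm_num) (by norm_num) (by norm_num) (by norm_num)
  have hsum : (5 / 11 : ℝ) ^ (5 / 3 : ℝ) + (5 / 17 : ℝ) ^ (5 / 3 : ℝ) +
      5 / 4 * (5 / 17 : ℝ) ^ (2 / 3 : ℝ) ≤ 1 := by
    linarith [five_div_seventeen_rpow_five_thirds_le, five_div_seventeen_rpow_two_thirds_le]
  have hdim := dimH_limitSet_le_of_separated (t := 5 / 6) one_le_two two_pos two_le add_two_le
    (by norm_num) (by norm_num; linarith only [hsum])
  simpa using hdim

theorem dimH_limitSet_le_of_add_three_le {A : Set ℕ} (hA : ∀ a ∈ A, 1 ≤ a)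
    (hsep : ∀ a ∈ A, ∀ b ∈ A, a < b → a + 3 ≤ b) : dimH (limitSet A) ≤ 5 / 6 := by
  have hfirst : (5 / 8 : ℝ) ^ (5 / 3 : ℝ) ≤ 46 / 100 := by
    exact_mod_cast rpow_div_le_of_pow_le_pow (x := 5 / 8) (y := 46 / 100) (m := 5) (n := 3)
      (by norm_num) (by norm_num) (by norm_num) (by norm_num)
  have hsum : (5 / 8 : ℝ) ^ (5 / 3 : ℝ) + (5 / 17 : ℝ) ^ (5 / 3 : ℝ) +
      5 / 6 * (5 / 17 : ℝ) ^ (2 / 3 : ℝ) ≤ 1 := by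
    linarith [five_div_seventeen_rpow_five_thirds_le, five_div_seventeen_rpow_two_thirds_le]
  have hdim := dimH_limitSet_le_of_separated (t := 5 / 6) le_rfl three_pos hA hsep
    (by norm_num) (by norm_num; linarith only [hsum])
  simpa using hdim

end SeparatedDigits

theorem mainTheorem10_general (A : Set ℕ) (hpos : ∀ a ∈ A, 1 ≤ a)
    (hdim : (5 / 6 : ENNReal) < dimH (limitSet A)) : NoLocalObstructions A := by
  obtain ⟨c, hc, hodd⟩ : ∃ c ∈ A, Odd c := by
    by_contra! heven
    exact hdim.not_ge <|
      dimH_limitSet_le_of_forall_even hpos fun a ha => Nat.not_odd_iff_even.1 (heven a ha)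
  obtain ⟨a, ha, b, hb, hlt, hle⟩ : ∃ a ∈ A, ∃ b ∈ A, a < b ∧ b ≤ a + 2 := by
    by_contra! hsep
    exact hdim.not_ge (dimH_limitSet_le_of_add_three_le hpos hsep)
  exact noLocalObstructions_of_odd_of_lt_of_le hpos ha hb hc hodd hlt hle

theorem mainTheorem10 (A : Finset ℕ) (hpos : ∀ a ∈ A, 1 ≤ a)
    (hdim : (5 / 6 : ENNReal) < dimH (limitSet (A : Set ℕ))) :
    NoLocalObstructions (A : Set ℕ) :=
  mainTheorem10_general A hpos hdim
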